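/- Let $\mathbb{R}^6$ have the axes $(x^1,x^2,x^3,t^3,t^2,t^1)$, and put $t=t^3$. Let $\mathfrak{Gr}^+\subset S^{19}\subset\mathbb{R}^{20}$ be the oriented Grassmannian of 3-planes in $\mathbb{R}^6$, each plane being given by its 20 Plücker coordinates (the $3\times3$ minors of a $3\times 6$ matrix whose rows span it), normalized by a positive factor. For $k\in\{1,2,3\}$, $\alpha\in[0,\frac{\pi}{4})$ and $O\in SO(3)$, let $P(O\cdot\alpha_k)\in\mathfrak{Gr}^+$ be the oriented plane spanned by the images under $O$ (acting on $x^1,x^2,x^3$ and fixing the $t$-axes) of the vector $\cos(4\alpha)\,x^k+\sin(4\alpha)\,t$ and the two remaining unit vectors $x^j$, $j\neq k$ (with the order $x^1,x^2,x^3$, the vector with index $k$ being replaced). Let $$SO(3)\cdot LGr=\{P(O\cdot\alpha_k) : O\in SO(3),\ k\in\{1,2,3\},\ \alpha\in[0,\tfrac{\pi}{4})\}\subset\mathfrak{Gr}^+ .$$ Let $SO(1,3)^e$ be the identity component of $SO(1,3)$, with its subgroup $SO(3)$ of spatial rotations. When $\alpha=\arctan\tanh\bigl(v/\sqrt{1-v^2}\bigr)$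 with $v\in[0,1)$, let $B(\alpha_k)\in SO(1,3)^e$ be the standard boost of velocity $v$ along the $k$-th axis, $t'=\frac{t+vx^k}{\sqrt{1-v^2}}$, $x'^k=\frac{x^k+vt}{\sqrt{1-v^2}}$, and let $B(O\cdot\alpha_k)=O\,B(\alpha_k)\,O^{-1}$. Then $SO(3)\cdot LGr$ is a $3$-dimensional embedded $C^\infty$ submanifold (of $\mathbb{R}^{20}$, hence of $\mathfrak{Gr}^+$), the homogeneous space $SO(1,3)^e/SO(3)$ with the quotient topology has a 3-dimensional $C^\infty$ structure for which the projection from $SO(1,3)^e$ is smooth and has smooth local sections, and, for these smooth structures, the assignment $$\mathcal{S}:\quad P(O\cdot\alpha_k)\longmapsto B(O\cdot\alpha_k)\,SO(3)$$ is a well-defined map and a ($C^\infty$) diffeomorphism $$\mathcal{S}:\ SO(3)\cdot LGr\longrightarrow SO(1,3)^e/SO(3).$$ -/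

import Mathlib

open scoped Manifold ContDiff Matrix

noncomputable section

namespace BoostFrames

/-! ### Oriented 3-planes in `ℝ⁶` and their Plücker coordinates

The columns `0, 1, 2, 3, 4, 5` of a `3 × 6` matrix are the axes `x¹, x², x³, t³, t², t¹`
of `ℝ⁶`, and the distinguished time axis is `t = t³`, i.e. column `3`. -/

/-- Index triples `i₀ < i₁ < i₂` in `{0, …, 5}`; there are 20 of them. -/
abbrev Triple : Type := {i : Fin 3 → Fin 6 // StrictMono i}

/-- The Plücker coordinates `p_{i₀ i₁ i₂}` of a `3 × 6` matrix: its `3 × 3` minors. -/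
def plucker (M : Matrix (Fin 3) (Fin 6) ℝ) : EuclideanSpace ℝ Triple :=
  WithLp.toLp 2 fun i => (M.submatrix id i.1).det

/-- The oriented Grassmannian `Gr⁺₃(ℝ⁶)` inside the unit sphere of `ℝ²⁰`: the Plücker coordinates,
up to a common positive multiple (hence normalized), of the `3 × 6` matrices of rank `3`. -/
def orientedGrassmannian : Set (EuclideanSpace ℝ Triple) :=
  {p | ∃ M : Matrix (Fin 3) (Fin 6) ℝ, M.rank = 3 ∧ p = ‖plucker M‖⁻¹ • plucker M}

/-- The oriented 3-plane spanned by the rows of a `3 × 6` matrix of rank `3`. -/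
def planeOf (M : Matrix (Fin 3) (Fin 6) ℝ) (hM : M.rank = 3) : orientedGrassmannian :=
  ⟨‖plucker M‖⁻¹ • plucker M, M, hM, rfl⟩

/-- The rows span the coordinate plane of `x¹, x², x³`, the base point `P₀`. -/
def initialFrame : Matrix (Fin 3) (Fin 6) ℝ :=
  !![1, 0, 0, 0, 0, 0;
     0, 1, 0, 0, 0, 0;
     0, 0, 1, 0, 0, 0]

/-- The rotation of `ℝ⁶` by the angle `4α` in the `(xᵏ, t)`-plane, for `k = 1, 2, 3`
(numbered `0, 1, 2`). -/
def planeRotation (k : Fin 3) (α : ℝ) : Matrix (Fin 6) (Fin 6) ℝ :=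
  ![!![Real.cos (4 * α), 0, 0, Real.sin (4 * α), 0, 0;
       0, 1, 0, 0, 0, 0;
       0, 0, 1, 0, 0, 0;
       -Real.sin (4 * α), 0, 0, Real.cos (4 * α), 0, 0;
       0, 0, 0, 0, 1, 0;
       0, 0, 0, 0, 0, 1],
    !![1, 0, 0, 0, 0, 0;
       0, Real.cos (4 * α), 0, Real.sin (4 * α), 0, 0;
       0, 0, 1, 0, 0, 0;
       0, -Real.sin (4 * α), 0, Real.cos (4 * α), 0, 0;
       0, 0, 0, 0, 1, 0;
       0, 0, 0, 0, 0, 1],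
    !![1, 0, 0, 0, 0, 0;
       0, 1, 0, 0, 0, 0;
       0, 0, Real.cos (4 * α), Real.sin (4 * α), 0, 0;
       0, 0, -Real.sin (4 * α), Real.cos (4 * α), 0, 0;
       0, 0, 0, 0, 1, 0;
       0, 0, 0, 0, 0, 1]] k

/-- The group of spatial rotations. -/
abbrev SO3 : Type := Matrix.specialOrthogonalGroup (Fin 3) ℝ

/-- A spatial rotation acting on `ℝ⁶`: it rotates `x¹, x², x³` and fixes the time axes. -/
def spatial6 (O : SO3) : Matrix (Fin 6) (Fin 6) ℝ :=
  Matrix.reindex finSumFinEquiv finSumFinEquiv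
    (Matrix.fromBlocks O.1 0 0 (1 : Matrix (Fin 3) (Fin 3) ℝ))

/-- The frame of the boost with parameter `α` along the `k`-th axis, rotated by `O`: each row `r`
of the unrotated frame is replaced by the vector `O r`. -/
def rotatedFrame (O : SO3) (k : Fin 3) (α : ℝ) : Matrix (Fin 3) (Fin 6) ℝ :=
  initialFrame * planeRotation k α * (spatial6 O)ᵀ

lemma SO3.mul_transpose (O : SO3) : O.1 * O.1ᵀ = 1 := by
  have h := (Matrix.mem_specialOrthogonalGroup_iff.1 O.2).1
  have := (Matrix.mem_orthogonalGroup_iff (Fin 3) ℝ).1 h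
  simpa [Matrix.star_eq_conjTranspose] using this

lemma SO3.transpose_mul (O : SO3) : O.1ᵀ * O.1 = 1 :=
  mul_eq_one_comm.1 (SO3.mul_transpose O)

lemma SO3.det_eq_one (O : SO3) : O.1.det = 1 :=
  (Matrix.mem_specialOrthogonalGroup_iff.1 O.2).2

lemma rotatedFrame_rank (O : SO3) (k : Fin 3) (α : ℝ) : (rotatedFrame O k α).rank = 3 := by
  have hA : planeRotation k α * (planeRotation k α)ᵀ = 1 := by
    have h := Real.sin_sq_add_cos_sq (4 * α)
    ext i j
    fin_cases k <;> fin_cases i <;> fin_cases j <;>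
      simp [planeRotation, Matrix.mul_apply, Fin.sum_univ_succ] <;> nlinarith
  have hR : (spatial6 O)ᵀ * spatial6 O = 1 := by
    simp only [spatial6, Matrix.reindex_apply, Matrix.transpose_submatrix,
      Matrix.submatrix_mul_equiv, Matrix.fromBlocks_transpose, Matrix.fromBlocks_multiply]
    simp [SO3.transpose_mul]
  have hE : initialFrame * initialFrameᵀ = 1 := by
    ext i j
    fin_cases i <;> fin_cases j <;> simp [initialFrame, Matrix.mul_apply, Fin.sum_univ_succ]
  have h : rotatedFrame O k α * (rotatedFrame O k α)ᵀ = 1 := by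
    calc rotatedFrame O k α * (rotatedFrame O k α)ᵀ
        = initialFrame * (planeRotation k α * ((spatial6 O)ᵀ * spatial6 O)
            * (planeRotation k α)ᵀ) * initialFrameᵀ := by
          simp only [rotatedFrame, Matrix.transpose_mul, Matrix.transpose_transpose,
            Matrix.mul_assoc]
      _ = 1 := by rw [hR, Matrix.mul_one, hA, Matrix.mul_one, hE]
  apply le_antisymm
  · simpa using Matrix.rank_le_card_height (rotatedFrame O k α)
  · have := Matrix.rank_mul_le_left (rotatedFrame O k α) (rotatedFrame O k α)ᵀ
    rw [h, Matrix.rank_one] at this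
    simpa using this

/-- The point `P(O·α)` of the Grassmannian, for the boost parameter `α` in the direction `k`. -/
def boostPoint (O : SO3) (k : Fin 3) (α : ℝ) : orientedGrassmannian :=
  planeOf (rotatedFrame O k α) (rotatedFrame_rank O k α)

/-- The set `SO(3)·LGr` of all spatially rotated boost frames, with `α ∈ [0, π/4)`. -/
def rotatedLGr : Set orientedGrassmannian :=
  {p | ∃ (O : SO3) (k : Fin 3), ∃ α ∈ Set.Ico (0 : ℝ) (Real.pi / 4), p = boostPoint O k α}

/-! ### The Lorentz group and its homogeneous space -/

/-- The Minkowski metric of signature `(1, 3)`; the index `0` is time. -/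
def minkowski : Matrix (Fin 4) (Fin 4) ℝ := Matrix.diagonal ![1, -1, -1, -1]

lemma minkowski_sq : minkowski * minkowski = 1 := by
  ext i j
  fin_cases i <;> fin_cases j <;> simp [minkowski]

/-- `SO(1,3)`: the real `4 × 4` matrices of determinant `1` that preserve the Minkowski metric. -/
def SO13 : Subgroup (GL (Fin 4) ℝ) where
  carrier := {A | A.1ᵀ * minkowski * A.1 = minkowski ∧ A.1.det = 1}
  one_mem' := by simp
  mul_mem' := by
    rintro A B ⟨hA, hA'⟩ ⟨hB, hB'⟩
    refine ⟨?_, by simp [hA', hB']⟩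
    calc (A.1 * B.1)ᵀ * minkowski * (A.1 * B.1)
        = B.1ᵀ * (A.1ᵀ * minkowski * A.1) * B.1 := by
          simp only [Matrix.transpose_mul, Matrix.mul_assoc]
      _ = minkowski := by rw [hA, hB]
  inv_mem' := by
    rintro A ⟨hA, hA'⟩
    have h1 : A.1 * A⁻¹.1 = 1 := A.mul_inv
    constructor
    · calc A⁻¹.1ᵀ * minkowski * A⁻¹.1
          = A⁻¹.1ᵀ * (A.1ᵀ * minkowski * A.1) * A⁻¹.1 := by rw [hA]
        _ = (A.1 * A⁻¹.1)ᵀ * minkowski * (A.1 * A⁻¹.1) := by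
          simp only [Matrix.transpose_mul, Matrix.mul_assoc]
        _ = minkowski := by rw [h1]; simp
    · have := congrArg Matrix.det h1
      simpa [Matrix.det_mul, hA'] using this

/-- A matrix of determinant `1` that preserves the Minkowski metric, as an element of `SO(1,3)`. -/
def SO13.mk (A : Matrix (Fin 4) (Fin 4) ℝ) (h : Aᵀ * minkowski * A = minkowski)
    (hdet : A.det = 1) : SO13 :=
  ⟨⟨A, minkowski * Aᵀ * minkowski,
    by
      have h2 : (minkowski * Aᵀ * minkowski) * A = 1 := by
        rw [Matrix.mul_assoc minkowski, Matrix.mul_assoc minkowski, h, minkowski_sq]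
      exact mul_eq_one_comm.1 h2,
    by rw [Matrix.mul_assoc minkowski, Matrix.mul_assoc minkowski, h, minkowski_sq]⟩, h, hdet⟩

/-- `SO(1,3)ᵉ`: the connected component of the identity in `SO(1,3)`. -/
abbrev SO13e : Subgroup SO13 := Subgroup.connectedComponentOfOne SO13

/-- The `4 × 4` matrix underlying an element of `SO(1,3)ᵉ`, as an array of entries. -/
def entries (g : SO13e) : Fin 4 → Fin 4 → ℝ := fun i j => g.1.1.1 i j

/-- A spatial rotation as a `4 × 4` matrix: it fixes the time axis. -/
def spatial4 (O : SO3) : Matrix (Fin 4) (Fin 4) ℝ :=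
  Matrix.reindex finSumFinEquiv finSumFinEquiv
    (Matrix.fromBlocks (1 : Matrix (Fin 1) (Fin 1) ℝ) 0 0 O.1)

lemma minkowski_eq : minkowski = Matrix.reindex finSumFinEquiv finSumFinEquiv
    (Matrix.fromBlocks (1 : Matrix (Fin 1) (Fin 1) ℝ) 0 0 (-1 : Matrix (Fin 3) (Fin 3) ℝ)) := by
  ext i j
  fin_cases i <;> fin_cases j <;> first | rfl | exact neg_zero.symm

/-- The embedding of `SO(3)` in `SO(1,3)`. -/
def rotation : SO3 →* SO13 where
  toFun O := SO13.mk (spatial4 O)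
    (by
      simp only [minkowski_eq, spatial4, Matrix.reindex_apply, Matrix.transpose_submatrix,
        Matrix.submatrix_mul_equiv, Matrix.fromBlocks_transpose, Matrix.fromBlocks_multiply]
      simp [SO3.transpose_mul])
    (by
      simp only [spatial4, Matrix.reindex_apply, Matrix.det_submatrix_equiv_self]
      simp [SO3.det_eq_one])
  map_one' := by
    apply Subtype.ext; apply Units.ext
    simp [SO13.mk, spatial4]
  map_mul' O O' := by
    apply Subtype.ext; apply Units.ext
    simp only [SO13.mk, spatial4, Matrix.reindex_apply, Subgroup.coe_mul, Units.val_mul,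
      Matrix.submatrix_mul_equiv, Matrix.fromBlocks_multiply]
    simp

/-- The subgroup `SO(3)` of `SO(1,3)ᵉ`: the elements of `SO(1,3)ᵉ` that are spatial rotations
(every spatial rotation occurs, as the rotation group is connected). -/
def SO3sub : Subgroup SO13e := (rotation.range).subgroupOf SO13e

/-- The homogeneous space `SO(1,3)ᵉ/SO(3)`, with the quotient topology. -/
abbrev BoostSpace : Type := SO13e ⧸ SO3sub

/-- The standard boost with velocity `v` along the `k`-th axis:
`t' = (t + v xᵏ) / √(1 - v²)` and `xᵏ' = (xᵏ + v t) / √(1 - v²)`. -/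
def boostMatrix (k : Fin 3) (v : ℝ) : Matrix (Fin 4) (Fin 4) ℝ :=
  ![!![1 / √(1 - v ^ 2), v / √(1 - v ^ 2), 0, 0;
       v / √(1 - v ^ 2), 1 / √(1 - v ^ 2), 0, 0;
       0, 0, 1, 0;
       0, 0, 0, 1],
    !![1 / √(1 - v ^ 2), 0, v / √(1 - v ^ 2), 0;
       0, 1, 0, 0;
       v / √(1 - v ^ 2), 0, 1 / √(1 - v ^ 2), 0;
       0, 0, 0, 1],
    !![1 / √(1 - v ^ 2), 0, 0, v / √(1 - v ^ 2);
       0, 1, 0, 0;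
       0, 0, 1, 0;
       v / √(1 - v ^ 2), 0, 0, 1 / √(1 - v ^ 2)]] k

lemma one_sub_sq_pos (v : Set.Ico (0 : ℝ) 1) : 0 < 1 - v.1 ^ 2 := by
  have := v.2.1
  have := v.2.2
  nlinarith

lemma boost_rel (v : Set.Ico (0 : ℝ) 1) :
    (1 / √(1 - v.1 ^ 2)) * (1 / √(1 - v.1 ^ 2))
      - (v.1 / √(1 - v.1 ^ 2)) * (v.1 / √(1 - v.1 ^ 2)) = 1 := by
  have h := one_sub_sq_pos v
  have hs := Real.mul_self_sqrt h.le
  have hne := (Real.sqrt_pos.2 h).ne'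
  rw [div_mul_div_comm, div_mul_div_comm, hs]
  field_simp

/-- The standard boost as an element of `SO(1,3)`. -/
def boost13 (k : Fin 3) (v : Set.Ico (0 : ℝ) 1) : SO13 :=
  SO13.mk (boostMatrix k v)
    (by
      have h := boost_rel v
      ext i j
      fin_cases k <;> fin_cases i <;> fin_cases j <;>
        simp [boostMatrix, minkowski, Matrix.mul_apply, Fin.sum_univ_succ,
          Matrix.diagonal_apply, Fin.succ] at h ⊢ <;> linarith)
    (by
      have h := boost_rel v
      fin_cases k <;>
        simp [boostMatrix, Matrix.det_succ_row_zero, Fin.sum_univ_succ, Fin.succAbove] at h ⊢ <;>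
        linarith)

lemma continuous_boostMatrix (k : Fin 3) :
    Continuous fun v : Set.Ico (0 : ℝ) 1 => boostMatrix k v := by
  have hne : ∀ v : Set.Ico (0 : ℝ) 1, √(1 - v.1 ^ 2) ≠ 0 :=
    fun v => (Real.sqrt_pos.2 (one_sub_sq_pos v)).ne'
  have h1 : Continuous fun v : Set.Ico (0 : ℝ) 1 => 1 / √(1 - v.1 ^ 2) :=
    continuous_const.div (by fun_prop) hne
  have h2 : Continuous fun v : Set.Ico (0 : ℝ) 1 => v.1 / √(1 - v.1 ^ 2) :=
    continuous_subtype_val.div (by fun_prop) hne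
  refine continuous_pi fun i => continuous_pi fun j => ?_
  fin_cases k <;> fin_cases i <;> fin_cases j <;>
    first | exact h1 | exact h2 | exact continuous_const

lemma conj_boost13_mem (R : SO13) (k : Fin 3) (v : Set.Ico (0 : ℝ) 1) :
    R * boost13 k v * R⁻¹ ∈ SO13e := by
  have hc : Continuous (boost13 k) := by
    refine Continuous.subtype_mk (Units.continuous_iff.2 ⟨continuous_boostMatrix k, ?_⟩) _
    exact (continuous_const.matrix_mul (continuous_boostMatrix k).matrix_transpose).matrix_mul
      continuous_const
  have hc' : Continuous fun v => R * boost13 k v * R⁻¹ :=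
    (continuous_const.mul hc).mul continuous_const
  have h0 : boost13 k ⟨0, by simp⟩ = 1 := by
    apply Subtype.ext; apply Units.ext
    ext i j
    fin_cases k <;> fin_cases i <;> fin_cases j <;> simp [boost13, SO13.mk, boostMatrix]
  have hpre : IsPreconnected (Set.univ : Set (Set.Ico (0 : ℝ) 1)) :=
    Subtype.preconnectedSpace isPreconnected_Ico |>.isPreconnected_univ
  exact (hpre.image _ hc'.continuousOn).subset_connectedComponent
    ⟨⟨0, by simp⟩, trivial, by dsimp only; rw [h0, mul_one, mul_inv_cancel]⟩ ⟨v, trivial, rfl⟩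

/-- The boost `B(O·α)`: the standard boost along the `k`-th axis conjugated by the spatial rotation
`O`, i.e. the standard boost along the image of the `k`-th axis under `O`. -/
def rotatedBoost (O : SO3) (k : Fin 3) (v : Set.Ico (0 : ℝ) 1) : SO13e :=
  ⟨rotation O * boost13 k v * (rotation O)⁻¹, conj_boost13_mem _ k v⟩

/-- The boost parameter `α = arctan (tanh (v / √(1 - v²)))` of the velocity `v`. -/
def boostParameter (v : ℝ) : ℝ := Real.arctan (Real.tanh (v / √(1 - v ^ 2)))

/-- The correspondence `P(O·α) ↦ B(O·α)`, as a relation. -/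
def IsCanonicalValue (p : rotatedLGr) (b : BoostSpace) : Prop :=
  ∃ (O : SO3) (k : Fin 3) (v : Set.Ico (0 : ℝ) 1),
    p.1 = boostPoint O k (boostParameter v) ∧ b = (rotatedBoost O k v : BoostSpace)

/-! ### The smooth structures -/

/-- A system of charts on `SO(3)·LGr` is its structure of an embedded submanifold: the inclusion
into `ℝ²⁰ ⊇ S¹⁹ ⊇ Gr⁺₃(ℝ⁶)` is a smooth embedding. -/
structure IsSubmanifoldStructure
    (c : ChartedSpace (EuclideanSpace ℝ (Fin 3)) rotatedLGr) : Prop where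
  isManifold : IsManifold (𝓡 3) ∞ rotatedLGr
  isSmoothEmbedding : Manifold.IsSmoothEmbedding (𝓡 3) 𝓘(ℝ, EuclideanSpace ℝ Triple) ∞
    fun p : rotatedLGr => (p.1.1 : EuclideanSpace ℝ Triple)

/-- A system of charts on `SO(1,3)ᵉ/SO(3)` is its structure of a homogeneous space: the projection
`SO(1,3)ᵉ → SO(1,3)ᵉ/SO(3)` is smooth and has smooth local sections. As `SO(1,3)ᵉ` is a
submanifold of the space of matrices, a map out of it is smooth if it extends locally to a smooth
map on an open set of matrices, and a map into it is smooth if its matrix entries are. -/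
structure IsHomogeneousStructure
    (c : ChartedSpace (EuclideanSpace ℝ (Fin 3)) BoostSpace) : Prop where
  isManifold : IsManifold (𝓡 3) ∞ BoostSpace
  smooth_proj : ∀ g : SO13e, ∃ U : Set (Fin 4 → Fin 4 → ℝ), IsOpen U ∧ entries g ∈ U ∧
    ∃ F : (Fin 4 → Fin 4 → ℝ) → BoostSpace,
      ContMDiffOn 𝓘(ℝ, Fin 4 → Fin 4 → ℝ) (𝓡 3) ∞ F U ∧
      ∀ h : SO13e, entries h ∈ U → F (entries h) = (h : BoostSpace)
  smooth_section : ∀ b : BoostSpace, ∃ V : Set BoostSpace, IsOpen V ∧ b ∈ V ∧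
    ∃ s : BoostSpace → SO13e,
      ContMDiffOn (𝓡 3) 𝓘(ℝ, Fin 4 → Fin 4 → ℝ) ∞ (fun x => entries (s x)) V ∧
      ∀ x ∈ V, (s x : BoostSpace) = x

end BoostFrames

end

open BoostFrames

noncomputable section

namespace BoostFrames

open Filter Topology

/-! ### The radial diffeomorphism `s u ↦ sinh (2 s) u` -/

/-! Both spaces are globally copies of ℝ³, and in suitable coordinates the correspondence is radial.

For u = O xᵏ, the normalized Plücker vector of P(O·α) is cos(4α) e + sin(4α) J(u), where e is the
coordinate vector of x¹x²x³ and J embeds ℝ³ isometrically in the orthogonal complement of e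
(`plucker_rotatedFrame`, `boostPoint_eq`). As 0 ≤ 4α < π, these points fill a 3-sphere minus the
antipode of e, and stereographic projection from that antipode sends P(O·α) to tan(2α) u.

A coset in SO(1,3)ᵉ/SO(3) is determined by the first column of any representative, even by its
spatial part, since the time entry is positive. The coset of B(O·α) has coordinate s u with s =
v/√(1-v²). For α = arctan tanh s the double-angle formula gives tan(2α) = sinh(2s), so the
correspondence reads sinh(2s) u ↦ s u. It depends only on points of ℝ³, hence not on the choice of
O, k, v. It is a diffeomorphism because sinh(2s)/s is an entire function of s² and the derivative at
0 is the invertible map 2·id.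

The smooth structures are given only by their characterizing properties. These already force both
coordinates to be diffeomorphisms onto ℝ³, so the radial computation applies to every admissible
pair of structures. -/

/-- The entire function `q ↦ ∑ qⁿ / (2n+1)!`, which satisfies `s * sinhc (s²) = sinh s`. -/
def sinhc : ℝ → ℝ :=
  FormalMultilinearSeries.ofScalarsSum (E := ℝ) fun n => ((2 * n + 1).factorial : ℝ)⁻¹

lemma contDiff_sinhc : ContDiff ℝ ∞ sinhc := by
  set c : ℕ → ℝ := fun n => ((2 * n + 1).factorial : ℝ)⁻¹ with hc
  have hrad : (FormalMultilinearSeries.ofScalars ℝ c).radius = ⊤ := by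
    apply FormalMultilinearSeries.ofScalars_radius_eq_top_of_tendsto
    · exact Eventually.of_forall fun n => inv_ne_zero (Nat.cast_ne_zero.2 (Nat.factorial_ne_zero _))
    -- The ratio is 1/((2n+3)(2n+2)), so the ratio test gives an infinite radius of convergence.
    · have h : ∀ n : ℕ, ‖c n.succ‖ / ‖c n‖ ≤ 1 / ((n : ℝ) + 1) := by
        intro n
        have hf : ((2 * n.succ + 1).factorial : ℝ)
            = (2 * n + 3) * ((2 * n + 2) * (2 * n + 1).factorial) := by
          rw [show 2 * n.succ + 1 = (2 * n + 2) + 1 by lia, Nat.factorial_succ,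
            Nat.factorial_succ]
          push_cast; ring
        have hpos : (0 : ℝ) < (2 * n + 1).factorial := by positivity
        simp only [hc, norm_inv, Real.norm_natCast, hf]
        rw [Real.norm_of_nonneg (by positivity), inv_div_inv,
          div_le_div_iff₀ (by positivity) (by positivity)]
        have : (0 : ℝ) ≤ n := n.cast_nonneg
        have h2 : (n : ℝ) + 1 ≤ (2 * n + 3) * (2 * n + 2) := by nlinarith
        nlinarith [mul_le_mul_of_nonneg_left h2 hpos.le]
      exact squeeze_zero (fun n => by positivity) h tendsto_one_div_add_atTop_nhds_zero_nat
  have h := (FormalMultilinearSeries.ofScalars ℝ c).hasFPowerSeriesOnBall (by rw [hrad]; simp)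
  rw [hrad] at h
  refine contDiff_iff_contDiffAt.2 fun x => ?_
  exact (h.analyticAt_of_mem (by simp)).contDiffAt

lemma mul_sinhc_sq (s : ℝ) : s * sinhc (s ^ 2) = Real.sinh s := by
  rw [sinhc, FormalMultilinearSeries.ofScalars_sum_eq, ← tsum_mul_left, Real.sinh_eq_tsum]
  refine tsum_congr fun n => ?_
  rw [smul_eq_mul, pow_succ s (2 * n), pow_mul]
  ring

lemma sinhc_zero : sinhc 0 = 1 := by
  simp [sinhc]

section Radial

variable {E : Type*} [NormedAddCommGroup E] [InnerProductSpace ℝ E]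

/-- The map `s u ↦ sinh (2 s) u` for unit vectors `u`. -/
def radialSinh (w : E) : E := (2 * sinhc ((2 * ‖w‖) ^ 2)) • w

/-- The map `s u ↦ (arsinh s / 2) u` for unit vectors `u`. -/
def radialArsinh (y : E) : E := (Real.arsinh ‖y‖ / (2 * ‖y‖)) • y

lemma radialSinh_smul (s : ℝ) {u : E} (hu : ‖u‖ = 1) :
    radialSinh (s • u) = Real.sinh (2 * s) • u := by
  rw [radialSinh, norm_smul, hu, mul_one, Real.norm_eq_abs, mul_pow, sq_abs, smul_smul,
    ← mul_pow, ← mul_sinhc_sq]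
  congr 1; ring

lemma norm_radialSinh (w : E) : ‖radialSinh w‖ = Real.sinh (2 * ‖w‖) := by
  rcases eq_or_ne w 0 with rfl | hw
  · simp [radialSinh]
  · have h : ‖(‖w‖⁻¹ • w : E)‖ = 1 := by
      rw [norm_smul, norm_inv, norm_norm, inv_mul_cancel₀ (norm_ne_zero_iff.2 hw)]
    have := radialSinh_smul ‖w‖ h
    rw [smul_inv_smul₀ (norm_ne_zero_iff.2 hw)] at this
    rw [this, norm_smul, h, mul_one, Real.norm_of_nonneg]
    rw [Real.sinh_nonneg_iff]; positivity

/-- The scalar factor depends on `w` only through `‖w‖ ^ 2`, which is smooth at 0 although `‖w‖` is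
not. -/
lemma contDiff_radialSinh : ContDiff ℝ ∞ (radialSinh : E → E) := by
  have h : ContDiff ℝ ∞ fun w : E => 2 * sinhc ((2 * ‖w‖) ^ 2) := by
    simp only [mul_pow]
    exact contDiff_const.mul (contDiff_sinhc.comp (contDiff_const.mul (contDiff_norm_sq ℝ)))
  exact h.smul contDiff_id

lemma norm_radialArsinh (y : E) : ‖radialArsinh y‖ = Real.arsinh ‖y‖ / 2 := by
  rcases eq_or_ne y 0 with rfl | hy
  · simp [radialArsinh]
  · have : 0 < ‖y‖ := norm_pos_iff.2 hy
    have h0 : 0 ≤ Real.arsinh ‖y‖ := Real.arsinh_nonneg_iff.2 this.le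
    rw [radialArsinh, norm_smul, Real.norm_of_nonneg (by positivity)]
    field_simp

lemma radialArsinh_radialSinh (w : E) : radialArsinh (radialSinh w) = w := by
  rcases eq_or_ne w 0 with rfl | hw
  · simp [radialArsinh, radialSinh]
  · have h0 : 0 < ‖w‖ := norm_pos_iff.2 hw
    have h1 : 0 < Real.sinh (2 * ‖w‖) := Real.sinh_pos_iff.2 (by positivity)
    rw [radialArsinh, norm_radialSinh, Real.arsinh_sinh, radialSinh, smul_smul]
    convert one_smul ℝ w
    have := mul_sinhc_sq (2 * ‖w‖)
    rw [← this] at h1 ⊢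
    have h2 : sinhc ((2 * ‖w‖) ^ 2) ≠ 0 := by
      intro h; rw [h] at h1; simp at h1
    generalize sinhc ((2 * ‖w‖) ^ 2) = a at h2
    field_simp

lemma radialSinh_radialArsinh (y : E) : radialSinh (radialArsinh y) = y := by
  rcases eq_or_ne y 0 with rfl | hy
  · simp [radialArsinh, radialSinh]
  · have h0 : 0 < ‖y‖ := norm_pos_iff.2 hy
    have hu : ‖(‖y‖⁻¹ • y : E)‖ = 1 := by
      rw [norm_smul, norm_inv, norm_norm, inv_mul_cancel₀ h0.ne']
    have : radialArsinh y = (Real.arsinh ‖y‖ / 2) • (‖y‖⁻¹ • y) := by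
      rw [radialArsinh, smul_smul]; congr 1; field_simp
    rw [this, radialSinh_smul _ hu, mul_div_cancel₀ _ (by norm_num : (2 : ℝ) ≠ 0),
      Real.sinh_arsinh, smul_inv_smul₀ h0.ne']

lemma contDiffAt_radialArsinh_of_ne {y : E} (hy : y ≠ 0) : ContDiffAt ℝ ∞ radialArsinh y := by
  have hn : ContDiffAt ℝ ∞ (fun y : E => ‖y‖) y := contDiffAt_norm ℝ hy
  have h2 : 2 * ‖y‖ ≠ 0 := by simpa using hy
  exact (((Real.contDiff_arsinh.contDiffAt).comp y hn).div
    (contDiffAt_const.mul hn) h2).smul contDiffAt_id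

/-- At 0 the formula divides by zero, so continuity is read off from the norm, arsinh(‖y‖)/2. It
must precede smoothness: the inverse function argument below starts from a homeomorphism. -/
lemma continuous_radialArsinh : Continuous (radialArsinh : E → E) := by
  rw [continuous_iff_continuousAt]
  intro y
  rcases eq_or_ne y 0 with rfl | hy
  · have h0 : radialArsinh (0 : E) = 0 := by simp [radialArsinh]
    rw [ContinuousAt, h0, tendsto_zero_iff_norm_tendsto_zero]
    simp only [norm_radialArsinh]
    have : Continuous fun y : E => Real.arsinh ‖y‖ / 2 :=
      (Real.continuous_arsinh.comp continuous_norm).div_const 2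
    simpa using this.tendsto 0
  · exact (contDiffAt_radialArsinh_of_ne hy).continuousAt

/-- The map `s u ↦ sinh (2 s) u` as a homeomorphism. -/
def radialHomeomorph : E ≃ₜ E where
  toFun := radialSinh
  invFun := radialArsinh
  left_inv := radialArsinh_radialSinh
  right_inv := radialSinh_radialArsinh
  continuous_toFun := contDiff_radialSinh.continuous
  continuous_invFun := continuous_radialArsinh

/-- In the product rule the derivative of the scalar factor is multiplied by `w = 0`; what remains
is the factor's value `2 * sinhc 0 = 2`. -/
lemma hasFDerivAt_radialSinh_zero :
    HasFDerivAt (radialSinh : E → E)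
      ((ContinuousLinearEquiv.smulLeft (Units.mk0 (2 : ℝ) two_ne_zero) : E ≃L[ℝ] E) :
        E →L[ℝ] E) 0 := by
  have h : ContDiff ℝ ∞ fun w : E => 2 * sinhc ((2 * ‖w‖) ^ 2) := by
    simp only [mul_pow]
    exact contDiff_const.mul (contDiff_sinhc.comp (contDiff_const.mul (contDiff_norm_sq ℝ)))
  have h1 := ((h.differentiable (by simp)).differentiableAt (x := (0 : E))).hasFDerivAt.smul
    (hasFDerivAt_id (𝕜 := ℝ) (0 : E))
  refine h1.congr_fderiv ?_
  ext x
  simp [sinhc_zero]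

/-- Away from 0 the formula is smooth; at 0 the inverse of a smooth homeomorphism with invertible
derivative is smooth. -/
lemma contDiff_radialArsinh [CompleteSpace E] : ContDiff ℝ ∞ (radialArsinh : E → E) := by
  refine contDiff_iff_contDiffAt.2 fun y => ?_
  rcases eq_or_ne y 0 with rfl | hy
  · have h0 : radialArsinh (0 : E) = 0 := by simp [radialArsinh]
    exact (radialHomeomorph (E := E)).toOpenPartialHomeomorph.contDiffAt_symm (by simp)
      (f₀' := ContinuousLinearEquiv.smulLeft (Units.mk0 (2 : ℝ) two_ne_zero))
      (by
        change HasFDerivAt radialSinh _ (radialArsinh 0)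
        rw [h0]; exact hasFDerivAt_radialSinh_zero)
      contDiff_radialSinh.contDiffAt
  · exact contDiffAt_radialArsinh_of_ne hy

end Radial

/-! ### Rotations and the images of the coordinate axes -/

/-- The image `O xᵏ` of the `k`-th axis under a rotation. -/
def rotatedAxis (O : SO3) (k : Fin 3) : EuclideanSpace ℝ (Fin 3) := !₂[O.1 0 k, O.1 1 k, O.1 2 k]

lemma norm_rotatedAxis (O : SO3) (k : Fin 3) : ‖rotatedAxis O k‖ = 1 := by
  have h := congrFun (congrFun (SO3.transpose_mul O) k) k
  simp only [Matrix.mul_apply, Fin.sum_univ_three, Matrix.transpose_apply, Matrix.one_apply_eq] at h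
  rw [EuclideanSpace.norm_eq, Fin.sum_univ_three, Real.sqrt_eq_one]
  simp only [rotatedAxis, Real.norm_eq_abs, sq_abs, Matrix.cons_val]
  linarith

/-- A `3 × 3` matrix with orthonormal columns and determinant `1` as a rotation. -/
def SO3.mk (A : Matrix (Fin 3) (Fin 3) ℝ) (h : Aᵀ * A = 1) (hdet : A.det = 1) : SO3 :=
  ⟨A, Matrix.mem_specialOrthogonalGroup_iff.2
    ⟨(Matrix.mem_orthogonalGroup_iff' (Fin 3) ℝ).2
      (by simpa [Matrix.star_eq_conjTranspose] using h), hdet⟩⟩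

/-- Every unit vector is the image of the first axis under a rotation: a half-turn about the
bisector, unless the vector is opposite to the axis. -/
lemma exists_rotatedAxis_eq {u : EuclideanSpace ℝ (Fin 3)} (hu : ‖u‖ = 1) :
    ∃ O : SO3, rotatedAxis O 0 = u := by
  have hsq : u 0 ^ 2 + u 1 ^ 2 + u 2 ^ 2 = 1 := by
    have h := EuclideanSpace.norm_sq_eq u
    rw [hu, Fin.sum_univ_three] at h
    simpa using h.symm
  by_cases h0 : 1 + u 0 = 0
  · have h1 : u 0 = -1 := by linarith
    have h2 : u 1 = 0 := by rw [h1] at hsq; nlinarith [sq_nonneg (u 1), sq_nonneg (u 2)]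
    have h3 : u 2 = 0 := by rw [h1] at hsq; nlinarith [sq_nonneg (u 1), sq_nonneg (u 2)]
    -- Here u = -x¹, and the half-turn about the third axis serves.
    refine ⟨SO3.mk !![-1, 0, 0; 0, -1, 0; 0, 0, 1] ?_ ?_, ?_⟩
    · ext i j
      fin_cases i <;> fin_cases j <;> simp [Matrix.mul_apply, Fin.sum_univ_three]
    · simp [Matrix.det_fin_three]
    · ext i
      fin_cases i <;> simp [rotatedAxis, SO3.mk, h1, h2, h3]
  · have hc : u 1 ^ 2 + u 2 ^ 2 = (1 + u 0) * (1 - u 0) := by linarith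
    obtain ⟨c, hcc⟩ : ∃ c : ℝ, c * (1 + u 0) = 1 := ⟨(1 + u 0)⁻¹, inv_mul_cancel₀ h0⟩
    have hc1 : c * (u 1 ^ 2 + u 2 ^ 2) = 1 - u 0 := by
      rw [hc, ← mul_assoc, hcc, one_mul]
    -- This is 2bbᵀ - 1 for the unit bisector b of x¹ and u; since |x¹ + u|² = 2(1 + u₀), the
    -- coefficient of (x¹ + u)(x¹ + u)ᵀ is c = 1/(1 + u₀).
    refine ⟨SO3.mk !![u 0, u 1, u 2; u 1, c * u 1 ^ 2 - 1, c * (u 1 * u 2);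
      u 2, c * (u 1 * u 2), c * u 2 ^ 2 - 1] ?_ ?_, ?_⟩
    · ext i j
      fin_cases i <;> fin_cases j <;> simp [Matrix.mul_apply, Fin.sum_univ_three]
      · linear_combination hsq
      · linear_combination u 1 * hc1
      · linear_combination u 2 * hc1
      · linear_combination u 1 * hc1
      · linear_combination c * u 1 ^ 2 * hc1 + u 1 ^ 2 * hcc * (-1)
      · linear_combination c * (u 1 * u 2) * hc1 - u 1 * u 2 * hcc
      · linear_combination u 2 * hc1
      · linear_combination c * (u 1 * u 2) * hc1 - u 1 * u 2 * hcc
      · linear_combination c * u 2 ^ 2 * hc1 + u 2 ^ 2 * hcc * (-1)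
    · simp only [Matrix.det_fin_three, Matrix.of_apply, Matrix.cons_val]
      linear_combination hsq - u 0 * hc1
    · ext i
      fin_cases i <;> simp [rotatedAxis, SO3.mk]

lemma exists_eq_norm_smul_rotatedAxis (y : EuclideanSpace ℝ (Fin 3)) :
    ∃ O : SO3, y = ‖y‖ • rotatedAxis O 0 := by
  rcases eq_or_ne y 0 with rfl | hy
  · exact ⟨1, by simp⟩
  · have h : ‖y‖ ≠ 0 := norm_ne_zero_iff.2 hy
    obtain ⟨O, hO⟩ := exists_rotatedAxis_eq (u := ‖y‖⁻¹ • y)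
      (by rw [norm_smul, norm_inv, norm_norm, inv_mul_cancel₀ h])
    exact ⟨O, by rw [hO, smul_inv_smul₀ h]⟩

/-! ### The coordinates of the boost frames -/

/-- The Plücker index `x¹x²x³`. -/
def spaceTriple : Triple := ⟨![0, 1, 2], by decide⟩

/-- The Plücker index `x²x³t`. -/
def timeTriple₀ : Triple := ⟨![1, 2, 3], by decide⟩

/-- The Plücker index `x¹x³t`. -/
def timeTriple₁ : Triple := ⟨![0, 2, 3], by decide⟩

/-- The Plücker index `x¹x²t`. -/
def timeTriple₂ : Triple := ⟨![0, 1, 3], by decide⟩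

/-- An increasing triple whose last index is neither 4 nor 5 lies in {0, 1, 2, 3}, which leaves four
choices. The other triples involve t² or t¹, where the boost frames have zero columns. -/
lemma Triple.cases (i : Triple) : i = spaceTriple ∨ i = timeTriple₀ ∨ i = timeTriple₁ ∨
    i = timeTriple₂ ∨ i.1 2 = 4 ∨ i.1 2 = 5 := by
  obtain ⟨i, hi⟩ := i
  have h01 : i 0 < i 1 := hi (by decide)
  have h12 : i 1 < i 2 := hi (by decide)
  have key : ∀ a b c : Fin 6, a < b → b < c →
      ![a, b, c] = ![0, 1, 2] ∨ ![a, b, c] = ![1, 2, 3] ∨ ![a, b, c] = ![0, 2, 3] ∨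
        ![a, b, c] = ![0, 1, 3] ∨ c = 4 ∨ c = 5 := by decide
  have hv : i = ![i 0, i 1, i 2] := by ext a; fin_cases a <;> rfl
  have := key _ _ _ h01 h12
  rw [← hv] at this
  simpa [spaceTriple, timeTriple₀, timeTriple₁, timeTriple₂, Subtype.ext_iff] using this

/-- The coordinate of `x¹x²x³`. -/
def spacePart : EuclideanSpace ℝ Triple →L[ℝ] ℝ := EuclideanSpace.proj spaceTriple

/-- The signed coordinates of the triples in which one of `x¹, x², x³` is replaced by `t`. -/
def timePart : EuclideanSpace ℝ Triple →L[ℝ] EuclideanSpace ℝ (Fin 3) :=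
  LinearMap.toContinuousLinearMap
    { toFun p := !₂[p timeTriple₀, -p timeTriple₁, p timeTriple₂]
      map_add' p q := by ext i; fin_cases i <;> simp [add_comm]
      map_smul' a p := by ext i; fin_cases i <;> simp }

/-- The right inverse of `timePart` with values in the coordinate subspace. -/
def timeIncl : EuclideanSpace ℝ (Fin 3) →L[ℝ] EuclideanSpace ℝ Triple :=
  LinearMap.toContinuousLinearMap
    { toFun x := EuclideanSpace.single timeTriple₀ (x 0) - EuclideanSpace.single timeTriple₁ (x 1)
        + EuclideanSpace.single timeTriple₂ (x 2)
      map_add' p q := by ext i; simp; split_ifs <;> ring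
      map_smul' a p := by ext i; simp; split_ifs <;> ring }

/-- The coordinate vector of `x¹x²x³`. -/
def spaceVec : EuclideanSpace ℝ Triple := EuclideanSpace.single spaceTriple 1

lemma timePart_timeIncl (x : EuclideanSpace ℝ (Fin 3)) : timePart (timeIncl x) = x := by
  ext i
  fin_cases i <;>
    simp [timePart, timeIncl, timeTriple₀, timeTriple₁, timeTriple₂]

lemma spacePart_timeIncl (x : EuclideanSpace ℝ (Fin 3)) : spacePart (timeIncl x) = 0 := by
  simp [spacePart, timeIncl, timeTriple₀, timeTriple₁, timeTriple₂, spaceTriple]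

lemma timePart_spaceVec : timePart spaceVec = 0 := by
  ext i
  fin_cases i <;>
    simp [timePart, spaceVec, timeTriple₀, timeTriple₁, timeTriple₂, spaceTriple]

lemma spacePart_spaceVec : spacePart spaceVec = 1 := by
  simp [spacePart, spaceVec]

lemma spatial6_eq (O : SO3) : spatial6 O =
    !![O.1 0 0, O.1 0 1, O.1 0 2, 0, 0, 0;
       O.1 1 0, O.1 1 1, O.1 1 2, 0, 0, 0;
       O.1 2 0, O.1 2 1, O.1 2 2, 0, 0, 0;
       0, 0, 0, 1, 0, 0;
       0, 0, 0, 0, 1, 0;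
       0, 0, 0, 0, 0, 1] := by
  ext i j
  fin_cases i <;> fin_cases j <;> rfl

lemma rotatedFrame_apply (O : SO3) (k : Fin 3) (α : ℝ) (a : Fin 3) (j : Fin 6) :
    rotatedFrame O k α a j =
      ![(if a = k then Real.cos (4 * α) else 1) * O.1 0 a,
        (if a = k then Real.cos (4 * α) else 1) * O.1 1 a,
        (if a = k then Real.cos (4 * α) else 1) * O.1 2 a,
        if a = k then Real.sin (4 * α) else 0, 0, 0] j := by
  rw [rotatedFrame, spatial6_eq]
  fin_cases k <;> fin_cases a <;> fin_cases j <;>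
    simp [Matrix.mul_apply, Fin.sum_univ_succ, planeRotation, initialFrame]

/-- With determinant 1 the adjugate is the inverse, hence the transpose: the cofactors of a rotation
are its own entries. -/
lemma SO3.adjugate_eq (O : SO3) : O.1.adjugate = O.1ᵀ := by
  have h : O.1.adjugate * O.1 = 1 := by rw [Matrix.adjugate_mul, SO3.det_eq_one, one_smul]
  calc O.1.adjugate = O.1.adjugate * (O.1 * O.1ᵀ) := by rw [SO3.mul_transpose, Matrix.mul_one]
    _ = O.1ᵀ := by rw [← Matrix.mul_assoc, h, Matrix.one_mul]

/-- The minor on x¹x²x³ is det O with one row scaled by cos(4α). In a minor that contains t, the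
t-column has the single nonzero entry sin(4α), in row `k`; expanding along it leaves, up to the sign
built into `timeIncl`, a cofactor of O, that is, a coordinate of O xᵏ. -/
lemma plucker_rotatedFrame (O : SO3) (k : Fin 3) (α : ℝ) :
    plucker (rotatedFrame O k α) =
      Real.cos (4 * α) • spaceVec + Real.sin (4 * α) • timeIncl (rotatedAxis O k) := by
  have hdet := SO3.det_eq_one O
  rw [Matrix.det_fin_three] at hdet
  have hadj : ∀ i j, O.1.adjugate i j = O.1 j i := fun i j => by
    rw [SO3.adjugate_eq, Matrix.transpose_apply]
  rw [Matrix.adjugate_fin_three] at hadj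
  ext i
  have hzero : i.1 2 = 4 ∨ i.1 2 = 5 → plucker (rotatedFrame O k α) i = 0 := by
    intro h
    refine Matrix.det_eq_zero_of_column_eq_zero 2 fun a => ?_
    rcases h with h | h <;> simp [Matrix.submatrix_apply, h, rotatedFrame_apply]
  have hne : ∀ j : Triple, j.1 2 ≠ 4 → j.1 2 ≠ 5 → i.1 2 = 4 ∨ i.1 2 = 5 → i ≠ j := by
    rintro j h4 h5 h rfl
    exact h.elim h4 h5
  rcases Triple.cases i with rfl | rfl | rfl | rfl | h
  · simp [plucker, Matrix.det_fin_three, rotatedFrame_apply, spaceVec, timeIncl, spaceTriple,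
      timeTriple₀, timeTriple₁, timeTriple₂]
    fin_cases k <;> simp <;> linear_combination Real.cos (4 * α) * hdet
  · have := hadj k 0
    simp [plucker, Matrix.det_fin_three, rotatedFrame_apply, spaceVec, timeIncl, spaceTriple,
      timeTriple₀, timeTriple₁, timeTriple₂, rotatedAxis]
    fin_cases k <;> simp at this ⊢ <;> linear_combination Real.sin (4 * α) * this
  · have := hadj k 1
    simp [plucker, Matrix.det_fin_three, rotatedFrame_apply, spaceVec, timeIncl, spaceTriple,
      timeTriple₀, timeTriple₁, timeTriple₂, rotatedAxis]
    fin_cases k <;> simp at this ⊢ <;> linear_combination -Real.sin (4 * α) * this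
  · have := hadj k 2
    simp [plucker, Matrix.det_fin_three, rotatedFrame_apply, spaceVec, timeIncl, spaceTriple,
      timeTriple₀, timeTriple₁, timeTriple₂, rotatedAxis]
    fin_cases k <;> simp at this ⊢ <;> linear_combination Real.sin (4 * α) * this
  · rw [hzero h]
    have h1 := hne spaceTriple (by decide) (by decide) h
    have h2 := hne timeTriple₀ (by decide) (by decide) h
    have h3 := hne timeTriple₁ (by decide) (by decide) h
    have h4 := hne timeTriple₂ (by decide) (by decide) h
    simp [spaceVec, timeIncl, h1, h2, h3, h4]

/-! ### Global charts -/

section GlobalChart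

variable {E M : Type*} [NormedAddCommGroup E] [NormedSpace ℝ E] [TopologicalSpace M]

/-- The charted space structure whose only chart is a homeomorphism. -/
abbrev globalChart (h : M ≃ₜ E) : ChartedSpace E M :=
  h.toOpenPartialHomeomorph.singletonChartedSpace rfl

lemma isManifold_globalChart (h : M ≃ₜ E) :
    letI := globalChart h
    IsManifold 𝓘(ℝ, E) ∞ M := by
  let := globalChart h
  have := h.toOpenPartialHomeomorph.singleton_hasGroupoid rfl (contDiffGroupoid ∞ 𝓘(ℝ, E))
  exact IsManifold.mk' _ _ _

lemma contMDiff_globalChart (h : M ≃ₜ E) :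
    letI := globalChart h
    ContMDiff 𝓘(ℝ, E) 𝓘(ℝ, E) ∞ h := by
  let := globalChart h
  have := isManifold_globalChart h
  rw [← contMDiffOn_univ]
  exact contMDiffOn_of_mem_maximalAtlas (e := h.toOpenPartialHomeomorph)
    (StructureGroupoid.subset_maximalAtlas _ rfl)

lemma contMDiff_globalChart_symm (h : M ≃ₜ E) :
    letI := globalChart h
    ContMDiff 𝓘(ℝ, E) 𝓘(ℝ, E) ∞ h.symm := by
  let := globalChart h
  have := isManifold_globalChart h
  rw [← contMDiffOn_univ]
  exact contMDiffOn_symm_of_mem_maximalAtlas (e := h.toOpenPartialHomeomorph)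
    (StructureGroupoid.subset_maximalAtlas _ rfl)

end GlobalChart

/-! ### Stereographic projection -/

/-- The cosine of the angle whose half has tangent `‖y‖`. -/
def stereoCos (y : EuclideanSpace ℝ (Fin 3)) : ℝ := (1 - ‖y‖ ^ 2) / (1 + ‖y‖ ^ 2)

lemma one_add_stereoCos_pos (y : EuclideanSpace ℝ (Fin 3)) : 0 < 1 + stereoCos y := by
  have h : 0 < 1 + ‖y‖ ^ 2 := by positivity
  rw [stereoCos, one_add_div h.ne']
  apply div_pos _ h
  linarith

lemma contDiff_stereoCos : ContDiff ℝ ∞ stereoCos :=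
  (contDiff_const.sub (contDiff_norm_sq ℝ)).div (contDiff_const.add (contDiff_norm_sq ℝ))
    fun y => by positivity

/-- Stereographic projection from the point opposite to `spaceVec`. -/
def stereo (p : EuclideanSpace ℝ Triple) : EuclideanSpace ℝ (Fin 3) :=
  (1 + spacePart p)⁻¹ • timePart p

/-- The inverse of stereographic projection. -/
def stereoInv (y : EuclideanSpace ℝ (Fin 3)) : EuclideanSpace ℝ Triple :=
  stereoCos y • spaceVec + (1 + stereoCos y) • timeIncl y

lemma spacePart_stereoInv (y : EuclideanSpace ℝ (Fin 3)) :
    spacePart (stereoInv y) = stereoCos y := by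
  simp [stereoInv, spacePart_spaceVec, spacePart_timeIncl]

lemma timePart_stereoInv (y : EuclideanSpace ℝ (Fin 3)) :
    timePart (stereoInv y) = (1 + stereoCos y) • y := by
  simp [stereoInv, timePart_spaceVec, timePart_timeIncl]

lemma stereo_stereoInv (y : EuclideanSpace ℝ (Fin 3)) : stereo (stereoInv y) = y := by
  rw [stereo, spacePart_stereoInv, timePart_stereoInv,
    inv_smul_smul₀ (one_add_stereoCos_pos y).ne']

lemma contDiffAt_stereo {p : EuclideanSpace ℝ Triple} (hp : 1 + spacePart p ≠ 0) :
    ContDiffAt ℝ ∞ stereo p :=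
  ((contDiffAt_const.add spacePart.contDiff.contDiffAt).inv hp).smul timePart.contDiff.contDiffAt

lemma contDiff_stereoInv : ContDiff ℝ ∞ stereoInv :=
  (contDiff_stereoCos.smul contDiff_const).add
    ((contDiff_const.add contDiff_stereoCos).smul timeIncl.contDiff)

/-- The four coordinate vectors involved are orthonormal, so the squared norm is cos² + sin² and the
normalization in `planeOf` has no effect. -/
lemma norm_plucker_rotatedFrame (O : SO3) (k : Fin 3) (α : ℝ) :
    ‖plucker (rotatedFrame O k α)‖ = 1 := by
  have hJ : ∀ x : EuclideanSpace ℝ (Fin 3), ‖timeIncl x‖ ^ 2 = ‖x‖ ^ 2 := by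
    intro x
    rw [← real_inner_self_eq_norm_sq, EuclideanSpace.norm_sq_eq, Fin.sum_univ_three]
    simp [-inner_self_eq_norm_sq_to_K, timeIncl, inner_add_left,
      inner_add_right, inner_sub_left, inner_sub_right, EuclideanSpace.inner_single_left,
      timeTriple₀, timeTriple₁, timeTriple₂]
    ring
  have hJe : inner ℝ spaceVec (timeIncl (rotatedAxis O k)) = 0 := by
    simp [spaceVec, timeIncl, EuclideanSpace.inner_single_left,
      timeTriple₀, timeTriple₁, timeTriple₂, spaceTriple]
  have he : ‖spaceVec‖ = 1 := by simp [spaceVec]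
  have hJ' := hJ (rotatedAxis O k)
  rw [norm_rotatedAxis, one_pow] at hJ'
  have h : ‖plucker (rotatedFrame O k α)‖ ^ 2 = 1 := by
    rw [plucker_rotatedFrame, norm_add_sq_real, norm_smul, norm_smul, mul_pow, mul_pow, hJ',
      inner_smul_left, inner_smul_right, hJe, he]
    simp
  rwa [pow_eq_one_iff_of_nonneg (norm_nonneg _) two_ne_zero] at h

lemma boostPoint_eq (O : SO3) (k : Fin 3) (α : ℝ) :
    (boostPoint O k α : EuclideanSpace ℝ Triple) =
      Real.cos (4 * α) • spaceVec + Real.sin (4 * α) • timeIncl (rotatedAxis O k) := by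
  change ‖plucker (rotatedFrame O k α)‖⁻¹ • plucker (rotatedFrame O k α) = _
  rw [norm_plucker_rotatedFrame, inv_one, one_smul, plucker_rotatedFrame]

/-- Half-angle formulas for the angle 4α. The bound α < π/4 makes cos(2α) positive and keeps the
point away from the centre of projection. -/
lemma boostPoint_eq_stereoInv (O : SO3) (k : Fin 3) {α : ℝ}
    (hα : α ∈ Set.Ico (0 : ℝ) (Real.pi / 4)) :
    (boostPoint O k α : EuclideanSpace ℝ Triple) =
      stereoInv (Real.tan (2 * α) • rotatedAxis O k) := by
  have hc : 0 < Real.cos (2 * α) :=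
    Real.cos_pos_of_mem_Ioo ⟨by linarith [hα.1, Real.pi_pos], by linarith [hα.2]⟩
  have hn : ‖Real.tan (2 * α) • rotatedAxis O k‖ ^ 2 = Real.tan (2 * α) ^ 2 := by
    rw [norm_smul, norm_rotatedAxis, mul_one, Real.norm_eq_abs, sq_abs]
  have h1 := Real.sin_sq_add_cos_sq (2 * α)
  have hC : stereoCos (Real.tan (2 * α) • rotatedAxis O k) = Real.cos (4 * α) := by
    rw [stereoCos, hn, Real.tan_eq_sin_div_cos, show 4 * α = 2 * (2 * α) by ring,
      Real.cos_two_mul (2 * α)]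
    generalize 2 * α = β at *
    field_simp
    rw [add_comm, h1]
    linarith
  rw [boostPoint_eq, stereoInv, hC, map_smul, smul_smul]
  congr 2
  rw [show 4 * α = 2 * (2 * α) by ring, Real.cos_two_mul (2 * α), Real.sin_two_mul,
    Real.tan_eq_sin_div_cos]
  generalize 2 * α = β at *
  field_simp
  ring

lemma half_arctan_mem {x : ℝ} (hx : 0 ≤ x) :
    Real.arctan x / 2 ∈ Set.Ico (0 : ℝ) (Real.pi / 4) :=
  ⟨by have := Real.arctan_nonneg.2 hx; positivity, by linarith [Real.arctan_lt_pi_div_two x]⟩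

lemma exists_boostPoint_eq_stereoInv (y : EuclideanSpace ℝ (Fin 3)) :
    ∃ p ∈ rotatedLGr, (p : EuclideanSpace ℝ Triple) = stereoInv y := by
  obtain ⟨O, hO⟩ := exists_eq_norm_smul_rotatedAxis y
  -- The parameter is α = arctan(‖y‖)/2, so that tan(2α) = ‖y‖. The axis `k = 0` suffices because
  -- rotations carry it to every direction.
  refine ⟨boostPoint O 0 _, ⟨O, 0, _, half_arctan_mem (norm_nonneg y), rfl⟩, ?_⟩
  rw [boostPoint_eq_stereoInv O 0 (half_arctan_mem (norm_nonneg y)),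
    mul_div_cancel₀ _ (two_ne_zero' ℝ), Real.tan_arctan, ← hO]

lemma stereoInv_mem_orientedGrassmannian (y : EuclideanSpace ℝ (Fin 3)) :
    stereoInv y ∈ orientedGrassmannian := by
  obtain ⟨p, -, hp⟩ := exists_boostPoint_eq_stereoInv y
  exact hp ▸ p.2

lemma stereoInv_mem_rotatedLGr (y : EuclideanSpace ℝ (Fin 3)) :
    (⟨stereoInv y, stereoInv_mem_orientedGrassmannian y⟩ : orientedGrassmannian) ∈ rotatedLGr := by
  obtain ⟨p, hp, h⟩ := exists_boostPoint_eq_stereoInv y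
  convert hp
  exact h.symm

lemma rotatedLGr.exists_stereoInv (p : rotatedLGr) :
    ∃ y, (p.1 : EuclideanSpace ℝ Triple) = stereoInv y := by
  obtain ⟨p, O, k, α, hα, rfl⟩ := p
  exact ⟨_, boostPoint_eq_stereoInv O k hα⟩

lemma rotatedLGr.one_add_spacePart_ne_zero (p : rotatedLGr) :
    1 + spacePart (p.1 : EuclideanSpace ℝ Triple) ≠ 0 := by
  obtain ⟨y, hy⟩ := rotatedLGr.exists_stereoInv p
  rw [hy, spacePart_stereoInv]
  exact (one_add_stereoCos_pos y).ne'

/-- Stereographic projection as a homeomorphism of `SO(3)·LGr` with `ℝ³`. -/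
def stereoHomeomorph : rotatedLGr ≃ₜ EuclideanSpace ℝ (Fin 3) where
  toFun p := stereo p.1.1
  invFun y := ⟨⟨stereoInv y, stereoInv_mem_orientedGrassmannian y⟩, stereoInv_mem_rotatedLGr y⟩
  left_inv p := by
    apply Subtype.ext; apply Subtype.ext
    obtain ⟨y, hy⟩ := rotatedLGr.exists_stereoInv p
    dsimp only
    rw [hy, stereo_stereoInv]
  right_inv := stereo_stereoInv
  continuous_toFun := by
    refine continuous_iff_continuousAt.2 fun p => ?_
    exact (contDiffAt_stereo (rotatedLGr.one_add_spacePart_ne_zero p)).continuousAt.comp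
      (f := fun p : rotatedLGr => (p.1.1 : EuclideanSpace ℝ Triple)) (by fun_prop)
  continuous_invFun :=
    (contDiff_stereoInv.continuous.subtype_mk _).subtype_mk _

lemma stereoHomeomorph_apply (p : rotatedLGr) : stereoHomeomorph p = stereo p.1.1 := rfl

lemma stereoHomeomorph_symm_apply (y : EuclideanSpace ℝ (Fin 3)) :
    ((stereoHomeomorph.symm y).1 : EuclideanSpace ℝ Triple) = stereoInv y := rfl

/-! ### The submanifold structure -/

/-- A chart of `ℝ²⁰` in which the inverse of stereographic projection is linear. -/
def stereoChart :
    OpenPartialHomeomorph (EuclideanSpace ℝ Triple) (EuclideanSpace ℝ Triple) where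
  -- The time part of `p` is replaced by `stereo p`, the x¹x²x³ coordinate is shifted by the value
  -- it has on the sphere, and the other coordinates are kept. The inverse recovers the time part as
  -- `(1 + spacePart p) • stereo p`.
  toFun p := timeIncl (stereo p) + (p - timeIncl (timePart p)) - stereoCos (stereo p) • spaceVec
  invFun q := q - timeIncl (timePart q) + stereoCos (timePart q) • spaceVec
    + (1 + (spacePart q + stereoCos (timePart q))) • timeIncl (timePart q)
  source := {p | 0 < 1 + spacePart p}
  target := {q | 0 < 1 + (spacePart q + stereoCos (timePart q))}
  map_source' p hp := by
    simpa [timePart_timeIncl, spacePart_timeIncl, timePart_spaceVec, spacePart_spaceVec] using hp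
  map_target' q hq := by
    simpa [timePart_timeIncl, spacePart_timeIncl, timePart_spaceVec, spacePart_spaceVec] using hq
  left_inv' p hp := by
    have hp' : 1 + spacePart p ≠ 0 := ne_of_gt hp
    have h : (1 + spacePart p) • timeIncl (stereo p) = timeIncl (timePart p) := by
      rw [stereo, map_smul, smul_inv_smul₀ hp']
    simp [timePart_timeIncl, spacePart_timeIncl, timePart_spaceVec, spacePart_spaceVec, h]
    abel
  right_inv' q hq := by
    have hq' : 1 + (spacePart q + stereoCos (timePart q)) ≠ 0 := ne_of_gt hq
    have h : stereo (q - timeIncl (timePart q) + stereoCos (timePart q) • spaceVec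
        + (1 + (spacePart q + stereoCos (timePart q))) • timeIncl (timePart q)) = timePart q := by
      simp [stereo, timePart_timeIncl, spacePart_timeIncl, timePart_spaceVec, spacePart_spaceVec,
        inv_smul_smul₀ hq']
    rw [h]
    simp [timePart_timeIncl, timePart_spaceVec]
    abel
  open_source := isOpen_lt continuous_const (continuous_const.add spacePart.continuous)
  open_target := isOpen_lt continuous_const (continuous_const.add
    (spacePart.continuous.add (contDiff_stereoCos.continuous.comp timePart.continuous)))
  continuousOn_toFun := by
    have h : ContinuousOn stereo {p | 0 < 1 + spacePart p} := fun p hp =>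
      (contDiffAt_stereo (ne_of_gt hp)).continuousAt.continuousWithinAt
    exact ((timeIncl.continuous.comp_continuousOn h).add (by fun_prop)).sub
      ((contDiff_stereoCos.continuous.comp_continuousOn h).smul continuousOn_const)
  continuousOn_invFun := by
    have h := contDiff_stereoCos.continuous
    fun_prop

lemma stereoChart_mem_maximalAtlas :
    stereoChart ∈ IsManifold.maximalAtlas 𝓘(ℝ, EuclideanSpace ℝ Triple) ∞
      (EuclideanSpace ℝ Triple) := by
  apply OpenPartialHomeomorph.mem_maximalAtlas_of_contMDiffOn
  · rw [contMDiffOn_iff_contDiffOn]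
    have h : ContDiffOn ℝ ∞ stereo stereoChart.source := fun p hp =>
      (contDiffAt_stereo (ne_of_gt hp)).contDiffWithinAt
    have h1 : ContDiff ℝ ∞ fun p : EuclideanSpace ℝ Triple => p - timeIncl (timePart p) := by
      fun_prop
    exact ((timeIncl.contDiff.comp_contDiffOn h).add h1.contDiffOn).sub
      ((contDiff_stereoCos.comp_contDiffOn h).smul contDiffOn_const)
  · rw [contMDiffOn_iff_contDiffOn]
    have h : ContDiff ℝ ∞ fun q : EuclideanSpace ℝ Triple => stereoCos (timePart q) :=
      contDiff_stereoCos.comp timePart.contDiff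
    have h1 : ContDiff ℝ ∞ fun p : EuclideanSpace ℝ Triple => p - timeIncl (timePart p) := by
      fun_prop
    exact ((h1.add (h.smul contDiff_const)).add
      ((contDiff_const.add (spacePart.contDiff.add h)).smul
        (timeIncl.contDiff.comp timePart.contDiff))).contDiffOn

lemma stereoChart_stereoInv (y : EuclideanSpace ℝ (Fin 3)) :
    stereoChart (stereoInv y) = timeIncl y := by
  change timeIncl (stereo (stereoInv y)) + (stereoInv y - timeIncl (timePart (stereoInv y)))
    - stereoCos (stereo (stereoInv y)) • spaceVec = timeIncl y
  rw [stereo_stereoInv, timePart_stereoInv, map_smul, stereoInv]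
  abel

lemma isSubmanifoldStructure_globalChart :
    IsSubmanifoldStructure (globalChart stereoHomeomorph) := by
  let := globalChart stereoHomeomorph
  have := isManifold_globalChart stereoHomeomorph
  refine ⟨isManifold_globalChart stereoHomeomorph, ?_,
    .comp .subtypeVal .subtypeVal⟩
  -- In the charts `stereoHomeomorph` and `stereoChart` the inclusion becomes the linear map
  -- `timeIncl`, a section of `timePart`; hence ℝ²⁰ splits as ℝ³ × ker `timePart`.
  refine Manifold.IsImmersionOfComplement.isImmersion (F := timePart.ker) fun p => ?_
  refine Manifold.IsImmersionAtOfComplement.mk_of_continuousAt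
    (continuous_subtype_val.comp continuous_subtype_val).continuousAt
    (ContinuousLinearEquiv.equivOfRightInverse timePart timeIncl timePart_timeIncl).symm
    stereoHomeomorph.toOpenPartialHomeomorph stereoChart (Set.mem_univ _) ?_
    (StructureGroupoid.subset_maximalAtlas _ rfl) stereoChart_mem_maximalAtlas ?_
  · obtain ⟨y, hy⟩ := rotatedLGr.exists_stereoInv p
    change 0 < 1 + spacePart p.1.1
    rw [hy, spacePart_stereoInv]
    exact one_add_stereoCos_pos y
  · intro y _
    simpa [stereoHomeomorph_symm_apply] using stereoChart_stereoInv y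

/-- The chart is smooth for every submanifold structure. -/
lemma IsSubmanifoldStructure.contMDiff_stereoHomeomorph
    {c : ChartedSpace (EuclideanSpace ℝ (Fin 3)) rotatedLGr} (hc : IsSubmanifoldStructure c) :
    ContMDiff (𝓡 3) (𝓡 3) ∞ stereoHomeomorph := fun p =>
  (contDiffAt_stereo (rotatedLGr.one_add_spacePart_ne_zero p)).contMDiffAt.comp
    (f := fun p : rotatedLGr => (p.1.1 : EuclideanSpace ℝ Triple)) p
    (hc.isSmoothEmbedding.contMDiff p)

/-- A continuous map is smooth once its composite with an immersion is, and here the composite is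
`stereoInv`. -/
lemma IsSubmanifoldStructure.contMDiff_stereoHomeomorph_symm
    {c : ChartedSpace (EuclideanSpace ℝ (Fin 3)) rotatedLGr} (hc : IsSubmanifoldStructure c) :
    ContMDiff (𝓡 3) (𝓡 3) ∞ stereoHomeomorph.symm :=
  (ContMDiff.iff_comp_isImmersion hc.isSmoothEmbedding.isImmersion).2
    ⟨stereoHomeomorph.symm.continuous, contDiff_stereoInv.contMDiff⟩

/-! ### The first column of a Lorentz transformation -/

/-- The spatial part of the first column of a `4 × 4` matrix. -/
def spatialColumn (m : Fin 4 → Fin 4 → ℝ) : EuclideanSpace ℝ (Fin 3) := !₂[m 1 0, m 2 0, m 3 0]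

lemma contDiff_spatialColumn : ContDiff ℝ ∞ spatialColumn := by
  rw [contDiff_euclidean]
  intro i
  fin_cases i <;> simp [spatialColumn] <;> fun_prop

lemma SO13.sum_mul_eq (A : SO13) (i j : Fin 4) :
    A.1.1 0 i * A.1.1 0 j - A.1.1 1 i * A.1.1 1 j - A.1.1 2 i * A.1.1 2 j - A.1.1 3 i * A.1.1 3 j
      = minkowski i j := by
  have h := congrFun (congrFun A.2.1 i) j
  rw [← h]
  simp [minkowski, Matrix.mul_apply, Fin.sum_univ_four, Matrix.diagonal_apply]
  ring

lemma SO13.continuous_entry (i j : Fin 4) : Continuous fun A : SO13 => A.1.1 i j :=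
  (Units.continuous_val.comp continuous_subtype_val).matrix_elem i j

lemma continuous_entries : Continuous entries :=
  continuous_pi fun i => continuous_pi fun j =>
    (SO13.continuous_entry i j).comp continuous_subtype_val

/-- Elements of the identity component preserve the direction of time. -/
lemma SO13e.entry_pos (g : SO13e) : 0 < entries g 0 0 := by
  -- The squared time entry is 1 plus a sum of squares, so positivity is equivalent to being at
  -- least 1. The condition is thus both open and closed, and it holds at the identity.
  have hiff : ∀ A : SO13, 0 < A.1.1 0 0 ↔ 1 ≤ A.1.1 0 0 := fun A => by
    refine ⟨fun h => ?_, fun h => by linarith⟩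
    have := SO13.sum_mul_eq A 0 0
    simp only [minkowski, Matrix.diagonal_apply_eq, Matrix.cons_val_zero] at this
    nlinarith [sq_nonneg (A.1.1 1 0), sq_nonneg (A.1.1 2 0), sq_nonneg (A.1.1 3 0)]
  have hclopen : IsClopen {A : SO13 | 0 < A.1.1 0 0} := by
    refine ⟨?_, isOpen_lt continuous_const (SO13.continuous_entry 0 0)⟩
    simp only [hiff]
    exact isClosed_le continuous_const (SO13.continuous_entry 0 0)
  exact hclopen.connectedComponent_subset (x := (1 : SO13)) (by simp) g.2

lemma entries_mul (g h : SO13e) (i j : Fin 4) :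
    entries (g * h) i j = ∑ k, entries g i k * entries h k j := rfl

lemma spatial4_eq (O : SO3) : spatial4 O =
    !![1, 0, 0, 0;
       0, O.1 0 0, O.1 0 1, O.1 0 2;
       0, O.1 1 0, O.1 1 1, O.1 1 2;
       0, O.1 2 0, O.1 2 1, O.1 2 2] := by
  ext i j
  fin_cases i <;> fin_cases j <;> rfl

lemma rotation_val (O : SO3) : (rotation O).1.1 = spatial4 O := rfl

lemma entries_zero_of_mem {r : SO13e} (hr : r ∈ SO3sub) (i : Fin 4) :
    entries r i 0 = (1 : Matrix (Fin 4) (Fin 4) ℝ) i 0 := by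
  obtain ⟨O, hO⟩ := hr
  change r.1.1.1 i 0 = _
  rw [← show rotation O = r.1 from hO, rotation_val, spatial4_eq]
  fin_cases i <;> rfl

/-- A Lorentz transformation that fixes the time axis is a spatial rotation. -/
lemma mem_SO3sub_of_entries_zero {r : SO13e}
    (hr : ∀ i, entries r i 0 = (1 : Matrix (Fin 4) (Fin 4) ℝ) i 0) : r ∈ SO3sub := by
  have h0 : r.1.1.1 0 0 = 1 := hr 0
  have h1 : r.1.1.1 1 0 = 0 := hr 1
  have h2 : r.1.1.1 2 0 = 0 := hr 2
  have h3 : r.1.1.1 3 0 = 0 := hr 3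
  -- Every other column is Minkowski-orthogonal to the first column (1, 0, 0, 0).
  have hrow : ∀ j : Fin 3, r.1.1.1 0 j.succ = 0 := fun j => by
    have := SO13.sum_mul_eq r.1 0 j.succ
    rw [h0, h1, h2, h3, minkowski, Matrix.diagonal_apply_ne _ (Fin.succ_ne_zero j).symm] at this
    linarith
  have hr1 : r.1.1.1 0 1 = 0 := hrow 0
  have hr2 : r.1.1.1 0 2 = 0 := hrow 1
  have hr3 : r.1.1.1 0 3 = 0 := hrow 2
  have hdet : r.1.1.1.det = 1 := r.1.2.2
  rw [Matrix.det_succ_column_zero, Fin.sum_univ_four, h0, h1, h2, h3] at hdet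
  refine ⟨SO3.mk (r.1.1.1.submatrix Fin.succ Fin.succ) ?_ ?_, ?_⟩
  · ext i j
    have := SO13.sum_mul_eq r.1 i.succ j.succ
    rw [hrow, hrow] at this
    rw [Matrix.mul_apply, Fin.sum_univ_three]
    have hm : minkowski i.succ j.succ = -(1 : Matrix (Fin 3) (Fin 3) ℝ) i j := by
      fin_cases i <;> fin_cases j <;> simp [minkowski]
    rw [hm] at this
    change r.1.1.1 1 i.succ * r.1.1.1 1 j.succ + r.1.1.1 2 i.succ * r.1.1.1 2 j.succ
      + r.1.1.1 3 i.succ * r.1.1.1 3 j.succ = _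
    linarith
  · simpa using hdet
  · apply Subtype.ext; apply Units.ext
    change spatial4 _ = r.1.1.1
    rw [spatial4_eq]
    ext i j
    fin_cases i <;> fin_cases j <;> simp [SO3.mk, h0, h1, h2, h3, hr1, hr2, hr3]

lemma spatialColumn_mul (g : SO13e) {r : SO13e} (hr : r ∈ SO3sub) :
    spatialColumn (entries (g * r)) = spatialColumn (entries g) := by
  have h : ∀ i, entries (g * r) i 0 = entries g i 0 := fun i => by
    simp [entries_mul, entries_zero_of_mem hr, Matrix.one_apply]
  simp only [spatialColumn, h]

/-- The time entry is the positive root of 1 plus the squared norm of the spatial part, so the whole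
first columns agree. Both elements then send the time axis to the same vector, and `g⁻¹ * h` fixes
it. -/
lemma inv_mul_mem_SO3sub {g h : SO13e}
    (hgh : spatialColumn (entries g) = spatialColumn (entries h)) : g⁻¹ * h ∈ SO3sub := by
  have h1 : entries g 1 0 = entries h 1 0 := congrArg (fun x => x 0) hgh
  have h2 : entries g 2 0 = entries h 2 0 := congrArg (fun x => x 1) hgh
  have h3 : entries g 3 0 = entries h 3 0 := congrArg (fun x => x 2) hgh
  have h0 : entries g 0 0 = entries h 0 0 := by
    have hg : entries g 0 0 * entries g 0 0 - entries g 1 0 * entries g 1 0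
      - entries g 2 0 * entries g 2 0 - entries g 3 0 * entries g 3 0 = minkowski 0 0 :=
      SO13.sum_mul_eq g.1 0 0
    have hh : entries h 0 0 * entries h 0 0 - entries h 1 0 * entries h 1 0
      - entries h 2 0 * entries h 2 0 - entries h 3 0 * entries h 3 0 = minkowski 0 0 :=
      SO13.sum_mul_eq h.1 0 0
    rw [h1, h2, h3] at hg
    exact (mul_self_inj (SO13e.entry_pos g).le (SO13e.entry_pos h).le).1 (by linarith)
  have hcol : ∀ k, entries h k 0 = entries g k 0 := fun k => by
    fin_cases k
    exacts [h0.symm, h1.symm, h2.symm, h3.symm]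
  refine mem_SO3sub_of_entries_zero fun i => ?_
  simp only [entries_mul, hcol]
  rw [← entries_mul, inv_mul_cancel]
  rfl

/-! ### The boost with a given first column -/

/-- The Lorentz factor of the boost with spatial part `w` of the first column. -/
def lorentzFactor (w : EuclideanSpace ℝ (Fin 3)) : ℝ := √(1 + ‖w‖ ^ 2)

lemma lorentzFactor_pos (w : EuclideanSpace ℝ (Fin 3)) : 0 < lorentzFactor w :=
  Real.sqrt_pos.2 (by positivity)

lemma lorentzFactor_sq (w : EuclideanSpace ℝ (Fin 3)) :
    lorentzFactor w ^ 2 = 1 + (w 0 ^ 2 + w 1 ^ 2 + w 2 ^ 2) := by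
  rw [lorentzFactor, Real.sq_sqrt (by positivity), EuclideanSpace.norm_sq_eq, Fin.sum_univ_three]
  simp

lemma contDiff_lorentzFactor : ContDiff ℝ ∞ lorentzFactor :=
  (contDiff_const.add (contDiff_norm_sq ℝ)).sqrt fun w => by positivity

/-- The symmetric Lorentz matrix whose first column has the spatial part `w`. -/
def pureBoostMatrix (w : EuclideanSpace ℝ (Fin 3)) : Matrix (Fin 4) (Fin 4) ℝ :=
  !![lorentzFactor w, w 0, w 1, w 2;
     w 0, 1 + (1 + lorentzFactor w)⁻¹ * w 0 ^ 2, (1 + lorentzFactor w)⁻¹ * (w 0 * w 1),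
       (1 + lorentzFactor w)⁻¹ * (w 0 * w 2);
     w 1, (1 + lorentzFactor w)⁻¹ * (w 0 * w 1), 1 + (1 + lorentzFactor w)⁻¹ * w 1 ^ 2,
       (1 + lorentzFactor w)⁻¹ * (w 1 * w 2);
     w 2, (1 + lorentzFactor w)⁻¹ * (w 0 * w 2), (1 + lorentzFactor w)⁻¹ * (w 1 * w 2),
       1 + (1 + lorentzFactor w)⁻¹ * w 2 ^ 2]

lemma contDiff_pureBoostMatrix :
    ContDiff ℝ ∞ fun w i j => pureBoostMatrix w i j := by
  have h := contDiff_lorentzFactor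
  have h1 : ContDiff ℝ ∞ fun w => (1 + lorentzFactor w)⁻¹ :=
    (contDiff_const.add h).inv fun w => by linarith [lorentzFactor_pos w]
  refine contDiff_pi.2 fun i => contDiff_pi.2 fun j => ?_
  fin_cases i <;> fin_cases j <;> simp [pureBoostMatrix] <;> fun_prop

lemma mul_sum_sq_eq (w : EuclideanSpace ℝ (Fin 3)) :
    (1 + lorentzFactor w)⁻¹ * (w 0 ^ 2 + w 1 ^ 2 + w 2 ^ 2) = lorentzFactor w - 1 := by
  have h := lorentzFactor_sq w
  have h0 : 1 + lorentzFactor w ≠ 0 := by linarith [lorentzFactor_pos w]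
  rw [show w 0 ^ 2 + w 1 ^ 2 + w 2 ^ 2 = (1 + lorentzFactor w) * (lorentzFactor w - 1) by linarith,
    inv_mul_cancel_left₀ h0]

/-- The boost whose first column has the spatial part `w`, as an element of `SO(1,3)`. -/
def pureBoost13 (w : EuclideanSpace ℝ (Fin 3)) : SO13 :=
  SO13.mk (pureBoostMatrix w)
    (by
      have h := lorentzFactor_sq w
      have h1 := mul_sum_sq_eq w
      have h2 : (1 + lorentzFactor w)⁻¹ * (1 + lorentzFactor w) = 1 :=
        inv_mul_cancel₀ (by linarith [lorentzFactor_pos w])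
      unfold pureBoostMatrix
      generalize (1 + lorentzFactor w)⁻¹ = a at *
      generalize lorentzFactor w = γ at *
      -- The Minkowski relations reduce to `key` for two spatial columns and to `key'` for a spatial
      -- column against the first; both follow from a|w|² = γ - 1 and a(1 + γ) = 1.
      have key : ∀ x y : ℝ, x * y - 2 * a * (x * y)
          - a ^ 2 * (x * y) * (w 0 ^ 2 + w 1 ^ 2 + w 2 ^ 2) = 0 := fun x y => by
        linear_combination -(a * (x * y)) * h1 - x * y * h2
      have key' : ∀ x : ℝ, γ * x - x - a * x * (w 0 ^ 2 + w 1 ^ 2 + w 2 ^ 2) = 0 := fun x => by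
        linear_combination -x * h1
      ext i j
      fin_cases i <;> fin_cases j <;>
        simp [minkowski, Matrix.mul_apply, Fin.sum_univ_four, Matrix.diagonal_apply]
      · linear_combination h
      · linear_combination key' (w 0)
      · linear_combination key' (w 1)
      · linear_combination key' (w 2)
      · linear_combination key' (w 0)
      · linear_combination key (w 0) (w 0)
      · linear_combination key (w 0) (w 1)
      · linear_combination key (w 0) (w 2)
      · linear_combination key' (w 1)
      · linear_combination key (w 0) (w 1)
      · linear_combination key (w 1) (w 1)
      · linear_combination key (w 1) (w 2)
      · linear_combination key' (w 2)
      · linear_combination key (w 0) (w 2)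
      · linear_combination key (w 1) (w 2)
      · linear_combination key (w 2) (w 2))
    (by
      have h := lorentzFactor_sq w
      have h1 := mul_sum_sq_eq w
      simp [pureBoostMatrix, Matrix.det_succ_row_zero, Fin.sum_univ_succ, Fin.succAbove]
      linear_combination lorentzFactor w * h1 + h)

lemma continuous_pureBoost13 : Continuous pureBoost13 := by
  have h : Continuous fun w => (pureBoostMatrix w : Matrix (Fin 4) (Fin 4) ℝ) :=
    contDiff_pureBoostMatrix.continuous
  refine Continuous.subtype_mk (Units.continuous_iff.2 ⟨h, ?_⟩) _
  exact (continuous_const.matrix_mul h.matrix_transpose).matrix_mul continuous_const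

lemma pureBoost13_zero : pureBoost13 0 = 1 := by
  apply Subtype.ext; apply Units.ext
  change pureBoostMatrix 0 = 1
  ext i j
  fin_cases i <;> fin_cases j <;> simp [pureBoostMatrix, lorentzFactor]

/-- The boost whose first column has the spatial part `w`. -/
def pureBoost (w : EuclideanSpace ℝ (Fin 3)) : SO13e :=
  ⟨pureBoost13 w, (isPreconnected_range continuous_pureBoost13).subset_connectedComponent
    ⟨0, pureBoost13_zero⟩ ⟨w, rfl⟩⟩

lemma continuous_pureBoost : Continuous pureBoost := continuous_pureBoost13.subtype_mk _

lemma spatialColumn_pureBoost (w : EuclideanSpace ℝ (Fin 3)) :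
    spatialColumn (entries (pureBoost w)) = w := by
  ext i
  fin_cases i <;> rfl

/-! ### The homogeneous space -/

/-- The homogeneous space `SO(1,3)ᵉ/SO(3)` is homeomorphic to `ℝ³`, by the spatial part of the first
column. -/
def columnHomeomorph : BoostSpace ≃ₜ EuclideanSpace ℝ (Fin 3) where
  toFun := Quotient.lift (fun g : SO13e => spatialColumn (entries g)) fun g h hgh => by
    have := spatialColumn_mul g (QuotientGroup.leftRel_apply.1 hgh)
    rwa [mul_inv_cancel_left, eq_comm] at this
  invFun w := (pureBoost w : BoostSpace)
  left_inv b := by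
    induction b using QuotientGroup.induction_on with
    | H g =>
      exact QuotientGroup.eq.2 (inv_mul_mem_SO3sub (spatialColumn_pureBoost _))
  right_inv := spatialColumn_pureBoost
  continuous_toFun := (contDiff_spatialColumn.continuous.comp continuous_entries).quotient_lift _
  continuous_invFun := continuous_quotient_mk'.comp continuous_pureBoost

lemma columnHomeomorph_mk (g : SO13e) :
    columnHomeomorph (g : BoostSpace) = spatialColumn (entries g) := rfl

lemma columnHomeomorph_symm_apply (w : EuclideanSpace ℝ (Fin 3)) :
    columnHomeomorph.symm w = (pureBoost w : BoostSpace) := rfl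

/-- The right factor O⁻¹ fixes the time axis, so the first column is that of the standard boost with
its spatial part rotated by O. -/
lemma columnHomeomorph_rotatedBoost (O : SO3) (k : Fin 3) (v : Set.Ico (0 : ℝ) 1) :
    columnHomeomorph (rotatedBoost O k v : BoostSpace) =
      (v.1 / √(1 - v.1 ^ 2)) • rotatedAxis O k := by
  have h : entries (rotatedBoost O k v) =
      spatial4 O * boostMatrix k v * spatial4 O⁻¹ := by
    change (rotation O * boost13 k v * (rotation O)⁻¹).1.1 = _
    rw [← map_inv]
    rfl
  rw [columnHomeomorph_mk, h, spatial4_eq, spatial4_eq]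
  ext i
  fin_cases i <;> fin_cases k <;>
    simp [spatialColumn, rotatedAxis, boostMatrix, Matrix.mul_apply, Fin.sum_univ_four, mul_comm]

lemma isHomogeneousStructure_globalChart :
    IsHomogeneousStructure (globalChart columnHomeomorph) := by
  let := globalChart columnHomeomorph
  refine ⟨isManifold_globalChart columnHomeomorph, fun g => ⟨Set.univ, isOpen_univ, trivial,
    fun m => columnHomeomorph.symm (spatialColumn m), ?_, fun h _ => ?_⟩,
    fun b => ⟨Set.univ, isOpen_univ, trivial, fun x => pureBoost (columnHomeomorph x), ?_,
      fun x _ => columnHomeomorph.symm_apply_apply x⟩⟩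
  · exact ((contMDiff_globalChart_symm columnHomeomorph).comp
      contDiff_spatialColumn.contMDiff).contMDiffOn
  · dsimp only
    rw [← columnHomeomorph_mk, Homeomorph.symm_apply_apply]
  · exact (contDiff_pureBoostMatrix.contMDiff.comp
      (contMDiff_globalChart columnHomeomorph)).contMDiffOn

/-- The chart is smooth for every structure of a homogeneous space. -/
lemma IsHomogeneousStructure.contMDiff_columnHomeomorph
    {c : ChartedSpace (EuclideanSpace ℝ (Fin 3)) BoostSpace} (hc : IsHomogeneousStructure c) :
    ContMDiff (𝓡 3) (𝓡 3) ∞ columnHomeomorph := fun b => by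
  -- The coordinate is constant on cosets, so it can be computed on a smooth local section.
  obtain ⟨V, hV, hb, s, hs, hsec⟩ := hc.smooth_section b
  have h : ContMDiffOn (𝓡 3) (𝓡 3) ∞ (fun x => spatialColumn (entries (s x))) V :=
    contDiff_spatialColumn.contMDiff.comp_contMDiffOn hs
  refine (h.congr fun x hx => ?_).contMDiffAt (hV.mem_nhds hb)
  rw [← columnHomeomorph_mk, hsec x hx]

/-- The inverse chart is the projection after `pureBoost`, whose entries are smooth, so the local
smooth extensions of the projection apply. -/
lemma IsHomogeneousStructure.contMDiff_columnHomeomorph_symm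
    {c : ChartedSpace (EuclideanSpace ℝ (Fin 3)) BoostSpace} (hc : IsHomogeneousStructure c) :
    ContMDiff (𝓡 3) (𝓡 3) ∞ columnHomeomorph.symm := fun w => by
  obtain ⟨U, hU, hw, F, hF, hFe⟩ := hc.smooth_proj (pureBoost w)
  have hcont : Continuous fun w => entries (pureBoost w) :=
    contDiff_pureBoostMatrix.continuous
  have h : ContMDiffOn (𝓡 3) (𝓡 3) ∞ (fun x => F (entries (pureBoost x)))
      ((fun w => entries (pureBoost w)) ⁻¹' U) :=
    hF.comp contDiff_pureBoostMatrix.contMDiff.contMDiffOn fun x hx => hx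
  refine (h.congr fun x hx => ?_).contMDiffAt ((hU.preimage hcont).mem_nhds hw)
  rw [hFe _ hx, columnHomeomorph_symm_apply]

/-! ### The canonical correspondence -/

lemma boostParameter_mem (v : Set.Ico (0 : ℝ) 1) :
    boostParameter v ∈ Set.Ico (0 : ℝ) (Real.pi / 4) := by
  have hs : 0 ≤ v.1 / √(1 - v.1 ^ 2) := div_nonneg v.2.1 (Real.sqrt_nonneg _)
  refine ⟨Real.arctan_nonneg.2 ?_, ?_⟩
  · rw [Real.tanh_eq_sinh_div_cosh]
    exact div_nonneg (Real.sinh_nonneg_iff.2 hs) (Real.cosh_pos _).le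
  · rw [← Real.arctan_one]
    exact Real.arctan_strictMono (Real.tanh_lt_one _)

/-- 2 tanh s/(1 - tanh² s) = 2 sinh s cosh s. This identity is where the choice α = arctan tanh s
enters. -/
lemma tan_two_mul_boostParameter (v : ℝ) :
    Real.tan (2 * boostParameter v) = Real.sinh (2 * (v / √(1 - v ^ 2))) := by
  rw [boostParameter, Real.tan_two_mul, Real.tan_arctan, Real.tanh_eq_sinh_div_cosh,
    Real.sinh_two_mul]
  generalize v / √(1 - v ^ 2) = s
  have hc : Real.cosh s ≠ 0 := (Real.cosh_pos s).ne'
  have h : 1 - (Real.sinh s / Real.cosh s) ^ 2 = (Real.cosh s ^ 2)⁻¹ := by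
    refine eq_inv_of_mul_eq_one_left ?_
    field_simp
    exact Real.cosh_sq_sub_sinh_sq s
  rw [h]
  field_simp

lemma exists_velocity {s : ℝ} (hs : 0 ≤ s) :
    ∃ v : Set.Ico (0 : ℝ) 1, v.1 / √(1 - v.1 ^ 2) = s := by
  have h0 : 0 < 1 + s ^ 2 := by positivity
  have h1 := Real.sq_sqrt h0.le
  have h2 : 0 < √(1 + s ^ 2) := Real.sqrt_pos.2 h0
  -- This solves s = v/√(1 - v²) for v.
  refine ⟨⟨s / √(1 + s ^ 2), by positivity, ?_⟩, ?_⟩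
  · rw [div_lt_one h2]
    exact Real.lt_sqrt_of_sq_lt (by linarith)
  · have h : 1 - (s / √(1 + s ^ 2)) ^ 2 = (√(1 + s ^ 2))⁻¹ ^ 2 := by
      rw [div_pow, inv_pow, h1]
      field_simp
      ring
    dsimp only
    rw [h, Real.sqrt_sq (by positivity), div_inv_eq_mul, div_mul_cancel₀ _ h2.ne']

/-- The correspondence `P(O·α) ↦ B(O·α)` as a homeomorphism: in the charts, it is
`sinh (2 s) u ↦ s u`. -/
def canonicalHomeomorph : rotatedLGr ≃ₜ BoostSpace :=
  (stereoHomeomorph.trans radialHomeomorph.symm).trans columnHomeomorph.symm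

lemma canonicalHomeomorph_eq_iff (p : rotatedLGr) (b : BoostSpace) :
    canonicalHomeomorph p = b ↔ stereoHomeomorph p = radialSinh (columnHomeomorph b) := by
  change columnHomeomorph.symm (radialHomeomorph.symm (stereoHomeomorph p)) = b ↔ _
  rw [Homeomorph.symm_apply_eq, Homeomorph.symm_apply_eq]
  rfl

/-- The relation is the graph of a homeomorphism, which contains the well-definedness: every choice
of O, k, v yields the coordinates sinh(2s) u and s u. Conversely, polar coordinates of
`columnHomeomorph b` supply a representation with `k = 0`. -/
lemma isCanonicalValue_iff (p : rotatedLGr) (b : BoostSpace) :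
    IsCanonicalValue p b ↔ canonicalHomeomorph p = b := by
  rw [canonicalHomeomorph_eq_iff]
  constructor
  · rintro ⟨O, k, v, hp, rfl⟩
    rw [columnHomeomorph_rotatedBoost, radialSinh_smul _ (norm_rotatedAxis O k),
      stereoHomeomorph_apply, hp, boostPoint_eq_stereoInv O k (boostParameter_mem v),
      stereo_stereoInv, tan_two_mul_boostParameter]
  · intro h
    obtain ⟨O, hO⟩ := exists_eq_norm_smul_rotatedAxis (columnHomeomorph b)
    obtain ⟨v, hv⟩ := exists_velocity (norm_nonneg (columnHomeomorph b))
    refine ⟨O, 0, v, ?_, ?_⟩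
    · apply Subtype.ext
      rw [hO, radialSinh_smul _ (norm_rotatedAxis O 0), ← hv, ← tan_two_mul_boostParameter,
        ← Homeomorph.eq_symm_apply] at h
      rw [h, stereoHomeomorph_symm_apply, boostPoint_eq_stereoInv O 0 (boostParameter_mem v)]
    · apply columnHomeomorph.injective
      rw [columnHomeomorph_rotatedBoost, hv, ← hO]

end BoostFrames

end

theorem proposition1 :
    (∃ c : ChartedSpace (EuclideanSpace ℝ (Fin 3)) rotatedLGr, IsSubmanifoldStructure c) ∧
    (∃ c : ChartedSpace (EuclideanSpace ℝ (Fin 3)) BoostSpace, IsHomogeneousStructure c) ∧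
    ∀ (cX : ChartedSpace (EuclideanSpace ℝ (Fin 3)) rotatedLGr)
      (cB : ChartedSpace (EuclideanSpace ℝ (Fin 3)) BoostSpace),
      IsSubmanifoldStructure cX → IsHomogeneousStructure cB →
      ∃ S : rotatedLGr ≃ₘ^∞⟮𝓡 3, 𝓡 3⟯ BoostSpace,
        ∀ (p : rotatedLGr) (b : BoostSpace), IsCanonicalValue p b ↔ S p = b := by
  refine ⟨⟨_, isSubmanifoldStructure_globalChart⟩, ⟨_, isHomogeneousStructure_globalChart⟩,
    fun cX cB hX hB => ⟨⟨canonicalHomeomorph.toEquiv, ?_, ?_⟩, isCanonicalValue_iff⟩⟩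
  · exact hB.contMDiff_columnHomeomorph_symm.comp
      (contDiff_radialArsinh.contMDiff.comp hX.contMDiff_stereoHomeomorph)
  · exact hX.contMDiff_stereoHomeomorph_symm.comp
      (contDiff_radialSinh.contMDiff.comp hB.contMDiff_columnHomeomorph)
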